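/- Let $N\ge 2$ and index agents cyclically modulo $N$. Let $L:\mathbb{R}^2\to\mathbb{R}$ be continuous with $\Omega=\{q: L(q)\le 0\}$ bounded, and let $\rho$ be a measurable density with $0<\underline\rho\le\rho\le\bar\rho$ on $\Omega$. Let the service cost $f(p,q)$ $(p\in\mathbb{R}^2,\ q\in\Omega)$ be continuous, and differentiable in $p$ with $\nabla_p f$ continuous in $(p,q)$. Each agent $i$ has a reference point $r_i(t)\in\mathbb{R}^2$ and a phase $\varphi_i(t)$ (relevant modulo $2\pi$). Its subregion $\Omega_i$ is the set of points of $\Omega$ of the form $r_i+s(\cos\theta,\sin\theta)$, $s\ge0$, with $\theta$ on the arc running counterclockwise from $\varphi_i$ to $\varphi_{i+1}$. Its workload $m_i=\int_{\Omega_i}\rho(q)\,dq$ is a function of $(r_i,\varphi_i,\varphi_{i+1})$. Suppose that for $t\ge 0$, with gains $\kappa_\varphi,\kappa_r>0$, the workloads $m_i$ are differentiable at the configurations visited, $$\dot\varphi_i=-\kappa_\varphi\Big[(2m_i-m_{i-1}-m_{i+1})\frac{\partial m_i}{\partial\varphi_i}+(2m_{i-1}-m_{i-2}-m_i)\frac{\partial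 m_{i-1}}{\partial\varphi_i}\Big],$$ $$\dot r_i=-\kappa_r\big[(2m_i-m_{i-1}-m_{i+1})\nabla_{r_i}m_i+2r_i-r_{i-1}-r_{i+1}\big],$$ and the reference points $r_i(t)$ stay bounded. Let $J_{\Omega_i}(p)=\int_{\Omega_i}f(p,q)\rho(q)\,dq$, and suppose that for every $t\ge0$ the point $p_i^*(t)$ minimizes $J_{\Omega_i}$ over the admissible set $\Pi_i=\{p\in\Omega_i:\nabla J_{\Omega_i}(p)=0\}$, that $p_i^*$ is continuous in $t$, and that the Hessian of $J_{\Omega_i}$ at $p_i^*(t)$ exists and has rank $2$, with inverse bounded uniformly in $t\ge0$. Let $\kappa_p>0$ and let the agents obey $\dot p_i=u_i$ with $u_i=-\kappa_p(p_i-p_i^*)$ for $t\ge0$. Then $\lim_{t\to\infty}\|p_i(t)-p_i^*(t)\|=0$ for every $i$. -/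

import Mathlib

open MeasureTheory Set Filter Topology

noncomputable section

namespace RotaryCoverage

/-- The Euclidean plane. -/
abbrev Plane := EuclideanSpace ℝ (Fin 2)

/-- The unit direction vector `(cos θ, sin θ)` of the phase angle `θ`. -/
def dir (θ : ℝ) : Plane := !₂[Real.cos θ, Real.sin θ]

/-- The angle in `[0, 2π)` by which one turns counterclockwise from the phase `α` to the
phase `β`. It depends on `α` and `β` modulo `2π` only. -/
def turn (α β : ℝ) : ℝ := toIcoMod Real.two_pi_pos 0 (β - α)

/-- The region `{L ≤ 0}`. -/
def region (L : Plane → ℝ) : Set Plane := {q | L q ≤ 0}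

/-- The part of `Ω` swept by a pointer based at `r` that turns counterclockwise from the
phase `α` to the phase `β`. -/
def subregion (Ω : Set Plane) (r : Plane) (α β : ℝ) : Set Plane :=
  {q | q ∈ Ω ∧ ∃ θ ∈ Icc α (α + turn α β), ∃ s : ℝ, 0 ≤ s ∧ q = r + s • dir θ}

/-- The workload `∫ ρ` of a subregion. -/
def workload (Ω : Set Plane) (ρ : Plane → ℝ) (r : Plane) (α β : ℝ) : ℝ :=
  ∫ q in subregion Ω r α β, ρ q

/-- The cost `∫ f(p, q) ρ(q) dq` of serving a subregion from the position `p`. -/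
def localCost (Ω : Set Plane) (ρ : Plane → ℝ) (f : Plane → Plane → ℝ)
    (r : Plane) (α β : ℝ) (p : Plane) : ℝ :=
  ∫ q in subregion Ω r α β, f p q * ρ q

/-- The critical points of the local cost that lie in the subregion. -/
def admissible (Ω : Set Plane) (ρ : Plane → ℝ) (f : Plane → Plane → ℝ)
    (r : Plane) (α β : ℝ) : Set Plane :=
  {p | p ∈ subregion Ω r α β ∧ gradient (localCost Ω ρ f r α β) p = 0}

/-- `p` minimizes the local cost over the admissible set. -/
def IsLocalOptimum (Ω : Set Plane) (ρ : Plane → ℝ) (f : Plane → Plane → ℝ)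
    (r : Plane) (α β : ℝ) (p : Plane) : Prop :=
  p ∈ admissible Ω ρ f r α β ∧
    ∀ p' ∈ admissible Ω ρ f r α β, localCost Ω ρ f r α β p ≤ localCost Ω ρ f r α β p'

/-- The Hessian (the derivative of the gradient) of the local cost at `p`. -/
def hessian (Ω : Set Plane) (ρ : Plane → ℝ) (f : Plane → Plane → ℝ)
    (r : Plane) (α β : ℝ) (p : Plane) : Plane →L[ℝ] Plane :=
  fderiv ℝ (gradient (localCost Ω ρ f r α β)) p

section Dynamics

variable {N : ℕ} [NeZero N]

/-- The workload `m i` at time `t`. Agents are indexed cyclically by `Fin N`. -/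
def m (Ω : Set Plane) (ρ : Plane → ℝ) (φ : Fin N → ℝ → ℝ) (r : Fin N → ℝ → Plane)
    (i : Fin N) (t : ℝ) : ℝ :=
  workload Ω ρ (r i t) (φ i t) (φ (i + 1) t)

/-- The partial derivative of `m i` with respect to `φ i`. -/
def dmOwn (Ω : Set Plane) (ρ : Plane → ℝ) (φ : Fin N → ℝ → ℝ) (r : Fin N → ℝ → Plane)
    (i : Fin N) (t : ℝ) : ℝ :=
  deriv (fun a : ℝ => workload Ω ρ (r i t) a (φ (i + 1) t)) (φ i t)

/-- The partial derivative of `m i` with respect to `φ (i + 1)`. -/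
def dmNext (Ω : Set Plane) (ρ : Plane → ℝ) (φ : Fin N → ℝ → ℝ) (r : Fin N → ℝ → Plane)
    (i : Fin N) (t : ℝ) : ℝ :=
  deriv (fun b : ℝ => workload Ω ρ (r i t) (φ i t) b) (φ (i + 1) t)

/-- The gradient of `m i` with respect to the reference point `r i`. -/
def dmRef (Ω : Set Plane) (ρ : Plane → ℝ) (φ : Fin N → ℝ → ℝ) (r : Fin N → ℝ → Plane)
    (i : Fin N) (t : ℝ) : Plane :=
  gradient (fun x : Plane => workload Ω ρ x (φ i t) (φ (i + 1) t)) (r i t)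

/-- The rotary-pointer partition dynamics on `[0, ∞)`. The phases are represented by real
numbers, which matter modulo `2π` only. The first clause says that the derivatives of the
workloads which occur on the right-hand sides exist at the configurations that are visited. -/
structure IsPartitionTrajectory (Ω : Set Plane) (ρ : Plane → ℝ) (κφ κr : ℝ)
    (φ : Fin N → ℝ → ℝ) (r : Fin N → ℝ → Plane) : Prop where
  differentiable : ∀ t, 0 ≤ t → ∀ i, DifferentiableAt ℝ
    (fun x : Plane × ℝ × ℝ => workload Ω ρ x.1 x.2.1 x.2.2) (r i t, φ i t, φ (i + 1) t)
  phase : ∀ t, 0 ≤ t → ∀ i, HasDerivWithinAt (φ i)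
    (-κφ *
      ((2 * m Ω ρ φ r i t - m Ω ρ φ r (i - 1) t - m Ω ρ φ r (i + 1) t) * dmOwn Ω ρ φ r i t
        + (2 * m Ω ρ φ r (i - 1) t - m Ω ρ φ r (i - 2) t - m Ω ρ φ r i t)
            * dmNext Ω ρ φ r (i - 1) t)) (Ici 0) t
  reference : ∀ t, 0 ≤ t → ∀ i, HasDerivWithinAt (r i)
    (-κr •
      ((2 * m Ω ρ φ r i t - m Ω ρ φ r (i - 1) t - m Ω ρ φ r (i + 1) t) • dmRef Ω ρ φ r i t
        + ((2 : ℝ) • r i t - r (i - 1) t - r (i + 1) t))) (Ici 0) t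

end Dynamics

end RotaryCoverage

end

/-! The partition dynamics are a weighted gradient flow of `energy`, the disagreement of neighbours
in workload and in reference point. So `energy` decreases at the rate `dissipation`, a weighted sum
of squared velocities (`IsPartitionTrajectory.hasDerivWithinAt_energy`). As `energy` is bounded
below, the speed of the configuration is square integrable in time.

The optimum moves at most proportionally to the configuration (`exists_eventually_norm_sub_le`). A
small change of base point and phases alters a subregion only inside thin strips along its two
bounding lines, so at a fixed position the gradient of the local cost changes at most linearly. The
bounded inverse of the Hessian turns this into a bound on the displacement of the zero of the
gradient.

By Cauchy–Schwarz, the displacement of the optimum over time windows of fixed length therefore tends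
to 0 (`eventually_norm_sub_le_of_speed_sq_le`); convergence of the optimum is not needed. The
proportional law forgets its initial error exponentially, hence tracks such a target
(`tendsto_norm_sub_of_relaxation`). -/

namespace RotaryCoverage

/-! ### Geometry of planar cones -/

/-- The signed distance of `x` from the line through the origin in the direction `dir α`. -/
noncomputable def cross (α : ℝ) (x : Plane) : ℝ := x 1 * Real.cos α - x 0 * Real.sin α

lemma norm_sq_eq (x : Plane) : ‖x‖ ^ 2 = x 0 ^ 2 + x 1 ^ 2 := by
  rw [EuclideanSpace.real_norm_sq_eq, Fin.sum_univ_two]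

lemma cross_smul_dir (α θ s : ℝ) : cross α (s • dir θ) = s * Real.sin (θ - α) := by
  simp [cross, dir, Real.sin_sub]; ring

lemma cross_sub (α : ℝ) (x y : Plane) : cross α (x - y) = cross α x - cross α y := by
  simp [cross]; ring

lemma abs_cross_le (α : ℝ) (x : Plane) : |cross α x| ≤ ‖x‖ := by
  apply abs_le_of_sq_le_sq _ (norm_nonneg _)
  rw [norm_sq_eq, cross]
  nlinarith [sq_nonneg (x 0 * Real.cos α + x 1 * Real.sin α), Real.sin_sq_add_cos_sq α]

lemma abs_cross_sub_le (α β : ℝ) (x : Plane) :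
    |cross α x - cross β x| ≤ ‖x‖ * |α - β| := by
  apply abs_le_of_sq_le_sq _ (by positivity)
  -- A chord is no longer than its arc: the left side is `2 - 2 * cos (α - β)`.
  have h : (Real.cos α - Real.cos β) ^ 2 + (Real.sin α - Real.sin β) ^ 2 ≤ (α - β) ^ 2 := by
    have := Real.one_sub_sq_div_two_le_cos (x := α - β)
    rw [Real.cos_sub] at this
    nlinarith [Real.sin_sq_add_cos_sq α, Real.sin_sq_add_cos_sq β]
  rw [mul_pow, sq_abs, norm_sq_eq, cross, cross]
  calc _ ≤ (x 0 ^ 2 + x 1 ^ 2) *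
        ((Real.cos α - Real.cos β) ^ 2 + (Real.sin α - Real.sin β) ^ 2) := by
        nlinarith [sq_nonneg (x 1 * (Real.sin α - Real.sin β) + x 0 * (Real.cos α - Real.cos β))]
    _ ≤ _ := by gcongr

lemma abs_cross_sub_cross_le {R : ℝ} {q r : Plane} (hq : ‖q‖ ≤ R) (hr : ‖r‖ ≤ R) (r' : Plane)
    (α α' : ℝ) : |cross α (q - r) - cross α' (q - r')| ≤ ‖r' - r‖ + 2 * R * |α' - α| := by
  have h1 : ‖q - r‖ ≤ 2 * R := (norm_sub_le _ _).trans (by linarith)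
  have h2 := abs_cross_sub_le α α' (q - r)
  have h3 := abs_cross_le α' (r' - r)
  have h4 : cross α (q - r) - cross α' (q - r')
      = (cross α (q - r) - cross α' (q - r)) + cross α' (r' - r) := by
    simp only [cross_sub]; ring
  rw [h4]
  calc _ ≤ _ := abs_add_le _ _
    _ ≤ ‖q - r‖ * |α - α'| + ‖r' - r‖ := add_le_add h2 h3
    _ ≤ 2 * R * |α - α'| + ‖r' - r‖ := by gcongr
    _ = _ := by rw [abs_sub_comm α]; ring

lemma exists_eq_norm_smul_dir (α : ℝ) (x : Plane) :
    ∃ ψ ∈ Ico 0 (2 * Real.pi), x = ‖x‖ • dir (α + ψ) := by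
  have key : ∃ θ, x = ‖x‖ • dir θ := by
    refine ⟨Complex.arg ⟨x 0, x 1⟩, ?_⟩
    have hn : ‖(⟨x 0, x 1⟩ : ℂ)‖ = ‖x‖ := by
      rw [← sq_eq_sq₀ (norm_nonneg _) (norm_nonneg _), norm_sq_eq, Complex.sq_norm,
        Complex.normSq_apply]
      ring
    have h1 := Complex.norm_mul_cos_arg ⟨x 0, x 1⟩
    have h2 := Complex.norm_mul_sin_arg ⟨x 0, x 1⟩
    rw [hn] at h1 h2
    ext i
    fin_cases i
    · simpa [dir] using h1.symm
    · simpa [dir] using h2.symm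
  obtain ⟨θ, hθ⟩ := key
  refine ⟨toIcoMod Real.two_pi_pos 0 (θ - α),
    toIcoMod_mem_Ico' Real.two_pi_pos (θ - α), ?_⟩
  have : α + toIcoMod Real.two_pi_pos 0 (θ - α)
      = θ - toIcoDiv Real.two_pi_pos 0 (θ - α) * (2 * Real.pi) := by
    rw [toIcoMod, zsmul_eq_mul]; ring
  rw [this]
  conv_lhs => rw [hθ]
  simp [dir, Real.cos_sub_int_mul_two_pi, Real.sin_sub_int_mul_two_pi]

lemma turn_mem_Ico (α β : ℝ) : turn α β ∈ Ico 0 (2 * Real.pi) :=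
  toIcoMod_mem_Ico' Real.two_pi_pos _

lemma cross_eq_cross_add_turn (α β : ℝ) (x : Plane) :
    cross β x = cross (α + turn α β) x := by
  have : α + turn α β = β - toIcoDiv Real.two_pi_pos 0 (β - α) * (2 * Real.pi) := by
    rw [turn, toIcoMod, zsmul_eq_mul]; ring
  rw [this]
  simp [cross, Real.cos_sub_int_mul_two_pi, Real.sin_sub_int_mul_two_pi]

/-- The closed cone of the directions from `α` to `β`. -/
def cone (α β : ℝ) : Set Plane :=
  {x | ∃ θ ∈ Icc α (α + turn α β), ∃ s : ℝ, 0 ≤ s ∧ x = s • dir θ}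

lemma mem_subregion_iff {Ω : Set Plane} {r q : Plane} {α β : ℝ} :
    q ∈ subregion Ω r α β ↔ q ∈ Ω ∧ q - r ∈ cone α β := by
  simp only [subregion, cone, mem_ofPred_eq, sub_eq_iff_eq_add']

lemma mem_cone_iff_exists {α β : ℝ} {x : Plane} :
    x ∈ cone α β ↔ ∃ ψ ∈ Icc 0 (turn α β), ∃ s : ℝ, 0 ≤ s ∧ x = s • dir (α + ψ) := by
  constructor
  · rintro ⟨θ, hθ, s, hs, rfl⟩
    exact ⟨θ - α, ⟨by linarith [hθ.1], by linarith [hθ.2]⟩, s, hs, by simp⟩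
  · rintro ⟨ψ, hψ, s, hs, rfl⟩
    exact ⟨α + ψ, ⟨by linarith [hψ.1], by linarith [hψ.2]⟩, s, hs, rfl⟩

lemma cross_start_smul_dir (α ψ s : ℝ) : cross α (s • dir (α + ψ)) = s * Real.sin ψ := by
  rw [cross_smul_dir, add_sub_cancel_left]

lemma cross_end_smul_dir (α β ψ s : ℝ) :
    cross β (s • dir (α + ψ)) = s * Real.sin (ψ - turn α β) := by
  rw [cross_eq_cross_add_turn, cross_smul_dir, add_sub_add_left_eq_sub]

/-- Boundary lines aside, a cone of opening at most `π` is the intersection of the half-planes `0 <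
cross α` and `cross β < 0`. -/
lemma cross_pos_and_neg_of_mem_cone {α β : ℝ} (h : turn α β ≤ Real.pi) {x : Plane}
    (hA : cross α x ≠ 0) (hB : cross β x ≠ 0) (hx : x ∈ cone α β) :
    0 < cross α x ∧ cross β x < 0 := by
  obtain ⟨ψ, hψ, s, hs, rfl⟩ := mem_cone_iff_exists.1 hx
  rw [cross_start_smul_dir] at hA ⊢
  rw [cross_end_smul_dir] at hB ⊢
  have h1 : 0 ≤ s * Real.sin ψ :=
    mul_nonneg hs (Real.sin_nonneg_of_nonneg_of_le_pi hψ.1 (hψ.2.trans h))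
  have h2 : s * Real.sin (ψ - turn α β) ≤ 0 :=
    mul_nonpos_of_nonneg_of_nonpos hs
      (Real.sin_nonpos_of_nonpos_of_neg_pi_le (by linarith [hψ.2]) (by linarith [hψ.1]))
  exact ⟨lt_of_le_of_ne h1 hA.symm, lt_of_le_of_ne h2 hB⟩

/-- This inclusion holds for every opening: the first sign forces `ψ < π`, and then an angle beyond
the turn would give `cross β` the wrong sign. -/
lemma mem_cone_of_cross_pos_and_neg {α β : ℝ} {x : Plane}
    (hx : 0 < cross α x ∧ cross β x < 0) : x ∈ cone α β := by
  obtain ⟨ψ, hψ, hxψ⟩ := exists_eq_norm_smul_dir α x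
  rw [hxψ, cross_start_smul_dir, cross_end_smul_dir] at hx
  refine mem_cone_iff_exists.2 ⟨ψ, ⟨hψ.1, ?_⟩, ‖x‖, norm_nonneg _, hxψ⟩
  by_contra! hlt
  have hp : ψ < Real.pi := by
    by_contra! hp
    have : Real.sin ψ ≤ 0 := by
      rw [← Real.sin_sub_two_pi]
      exact Real.sin_nonpos_of_nonpos_of_neg_pi_le (by linarith [hψ.2]) (by linarith)
    nlinarith [hx.1, norm_nonneg x]
  have h2 : 0 ≤ Real.sin (ψ - turn α β) :=
    Real.sin_nonneg_of_nonneg_of_le_pi (by linarith) (by linarith [(turn_mem_Ico α β).1])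
  nlinarith [hx.2, norm_nonneg x]

/-- From opening `π` on, the cone is instead the union of the two half-planes, boundary lines aside.
The inclusion in the union holds for every opening: `ψ < π` gives the first sign, `π ≤ ψ` the
second. -/
lemma cross_pos_or_neg_of_mem_cone {α β : ℝ} {x : Plane}
    (hA : cross α x ≠ 0) (hB : cross β x ≠ 0) (hx : x ∈ cone α β) :
    0 < cross α x ∨ cross β x < 0 := by
  obtain ⟨ψ, hψ, s, hs, rfl⟩ := mem_cone_iff_exists.1 hx
  rw [cross_start_smul_dir] at hA ⊢
  rw [cross_end_smul_dir] at hB ⊢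
  rcases lt_or_ge ψ Real.pi with hp | hp
  · exact Or.inl (lt_of_le_of_ne
      (mul_nonneg hs (Real.sin_nonneg_of_nonneg_of_le_pi hψ.1 hp.le)) hA.symm)
  · refine Or.inr (lt_of_le_of_ne (mul_nonpos_of_nonneg_of_nonpos hs ?_) hB)
    exact Real.sin_nonpos_of_nonpos_of_neg_pi_le (by linarith [hψ.2])
      (by linarith [(turn_mem_Ico α β).2])

lemma mem_cone_of_cross_pos_or_neg {α β : ℝ} (h : Real.pi ≤ turn α β) {x : Plane}
    (hx : 0 < cross α x ∨ cross β x < 0) : x ∈ cone α β := by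
  obtain ⟨ψ, hψ, hxψ⟩ := exists_eq_norm_smul_dir α x
  rw [hxψ, cross_start_smul_dir, cross_end_smul_dir] at hx
  refine mem_cone_iff_exists.2 ⟨ψ, ⟨hψ.1, ?_⟩, ‖x‖, norm_nonneg _, hxψ⟩
  by_contra! hlt
  have h1 : Real.sin ψ ≤ 0 := by
    rw [← Real.sin_sub_two_pi]
    exact Real.sin_nonpos_of_nonpos_of_neg_pi_le (by linarith [hψ.2]) (by linarith)
  have h2 : 0 ≤ Real.sin (ψ - turn α β) :=
    Real.sin_nonneg_of_nonneg_of_le_pi (by linarith) (by linarith [hψ.2])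
  rcases hx with hx | hx <;> nlinarith [norm_nonneg x]


/-- Away from the lines that bound two cones which are both convex or both have convex complement,
membership only depends on the signs of `cross`. -/
lemma mem_cone_iff_of_abs_cross_sub_le {α β α' β' w : ℝ} {x x' : Plane}
    (hT : (turn α β ≤ Real.pi ∧ turn α' β' ≤ Real.pi) ∨
      (Real.pi ≤ turn α β ∧ Real.pi ≤ turn α' β'))
    (hA : w < |cross α x|) (hB : w < |cross β x|)
    (hA' : |cross α x - cross α' x'| ≤ w) (hB' : |cross β x - cross β' x'| ≤ w) :
    x ∈ cone α β ↔ x' ∈ cone α' β' := by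
  have sign : ∀ a a' : ℝ, w < |a| → |a - a'| ≤ w →
      a ≠ 0 ∧ a' ≠ 0 ∧ (0 < a ↔ 0 < a') ∧ (a < 0 ↔ a' < 0) := by
    intro a a' h h'
    rw [abs_le] at h'
    rcases lt_abs.1 h with h | h
    · have h1 : 0 < a' := by linarith
      have h2 : 0 < a := by linarith
      exact ⟨h2.ne', h1.ne', by simp [h1, h2], iff_of_false (not_lt.2 h2.le) (not_lt.2 h1.le)⟩
    · have h1 : a' < 0 := by linarith
      have h2 : a < 0 := by linarith
      exact ⟨h2.ne, h1.ne, iff_of_false (not_lt.2 h2.le) (not_lt.2 h1.le), by simp [h1, h2]⟩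
  obtain ⟨a1, a2, a3, -⟩ := sign _ _ hA hA'
  obtain ⟨b1, b2, -, b3⟩ := sign _ _ hB hB'
  rcases hT with ⟨h, h'⟩ | ⟨h, h'⟩
  · exact ⟨fun hx => mem_cone_of_cross_pos_and_neg (by
      rw [← a3, ← b3]; exact cross_pos_and_neg_of_mem_cone h a1 b1 hx),
      fun hx => mem_cone_of_cross_pos_and_neg (by
      rw [a3, b3]; exact cross_pos_and_neg_of_mem_cone h' a2 b2 hx)⟩
  · exact ⟨fun hx => mem_cone_of_cross_pos_or_neg h' (by
      rw [← a3, ← b3]; exact cross_pos_or_neg_of_mem_cone a1 b1 hx),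
      fun hx => mem_cone_of_cross_pos_or_neg h (by
      rw [a3, b3]; exact cross_pos_or_neg_of_mem_cone a2 b2 hx)⟩

lemma continuousAt_turn {α β : ℝ} (h : turn α β ≠ 0) :
    ContinuousAt (fun x : ℝ × ℝ => turn x.1 x.2) (α, β) := by
  have h' : ¬ (β - α) ≡ 0 [PMOD (2 * Real.pi)] := fun hm =>
    h ((AddCommGroup.modEq_iff_toIcoMod_eq_left Real.two_pi_pos).1 hm.symm)
  exact ContinuousAt.comp (f := fun x : ℝ × ℝ => x.2 - x.1) (x := (α, β))
    (continuousAt_toIcoMod Real.two_pi_pos 0 h') (by fun_prop)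

/-- `turn` can jump only where it vanishes. At a turn of exactly `π` both descriptions of the cone
are valid, which is why weak inequalities suffice. -/
lemma eventually_turn_same_side {α β : ℝ} (h : turn α β ≠ 0) :
    ∀ᶠ x : ℝ × ℝ in 𝓝 (α, β), (turn α β ≤ Real.pi ∧ turn x.1 x.2 ≤ Real.pi) ∨
      (Real.pi ≤ turn α β ∧ Real.pi ≤ turn x.1 x.2) := by
  have hc : Tendsto (fun x : ℝ × ℝ => turn x.1 x.2) (𝓝 (α, β)) (𝓝 (turn α β)) :=
    continuousAt_turn h
  rcases lt_trichotomy (turn α β) Real.pi with h1 | h1 | h1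
  · filter_upwards [hc.eventually_lt_const h1] with x hx
    exact Or.inl ⟨h1.le, hx.le⟩
  · refine Eventually.of_forall fun x => ?_
    rcases le_total (turn x.1 x.2) Real.pi with h2 | h2
    · exact Or.inl ⟨h1.le, h2⟩
    · exact Or.inr ⟨h1.ge, h2⟩
  · filter_upwards [hc.eventually_const_lt h1] with x hx
    exact Or.inr ⟨h1.le, hx.le⟩

/-! ### Measurability and variation of the subregions -/

lemma measurableSet_cone (α β : ℝ) : MeasurableSet (cone α β) := by
  have : cone α β = ⋃ n : ℕ, (fun z : ℝ × ℝ => z.2 • dir z.1) ''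
      (Icc α (α + turn α β) ×ˢ Icc (0 : ℝ) n) := by
    ext x
    simp only [cone, mem_ofPred_eq, mem_iUnion, mem_image, mem_prod, Prod.exists]
    constructor
    · rintro ⟨θ, hθ, s, hs, rfl⟩
      obtain ⟨n, hn⟩ := exists_nat_ge s
      exact ⟨n, θ, s, ⟨hθ, hs, hn⟩, rfl⟩
    · rintro ⟨n, θ, s, ⟨hθ, hs, hn⟩, rfl⟩
      exact ⟨θ, hθ, s, hs, rfl⟩
  rw [this]
  refine MeasurableSet.iUnion fun n => IsCompact.measurableSet ?_
  refine (isCompact_Icc.prod isCompact_Icc).image ?_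
  unfold dir
  fun_prop

lemma measurableSet_subregion {Ω : Set Plane} (hΩ : MeasurableSet Ω) (r : Plane) (α β : ℝ) :
    MeasurableSet (subregion Ω r α β) := by
  have : subregion Ω r α β = Ω ∩ (fun q => q - r) ⁻¹' cone α β := by
    ext q; exact mem_subregion_iff
  rw [this]
  exact hΩ.inter ((measurableSet_cone α β).preimage (by fun_prop))

lemma subregion_subset (Ω : Set Plane) (r : Plane) (α β : ℝ) : subregion Ω r α β ⊆ Ω :=
  fun _ h => h.1

/-- The part of the disc of radius `R` within distance `w` of the line through `r` in the
direction `dir α`. -/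
def strip (R : ℝ) (r : Plane) (α w : ℝ) : Set Plane := {q | ‖q‖ ≤ R ∧ |cross α (q - r)| ≤ w}

/-- In an orthonormal basis whose second vector is the unit normal of the line, the strip lies in a
rectangle with sides `2 * R` and `2 * w`. -/
lemma volume_strip_le {R w : ℝ} (hR : 0 ≤ R) (r : Plane) (α : ℝ) :
    volume (strip R r α w) ≤ ENNReal.ofReal (4 * R * w) := by
  obtain ⟨b, hb⟩ : ∃ b : OrthonormalBasis (Fin 2) ℝ Plane, ∀ x, b.repr x 1 = cross α x := by
    have hn : ‖(!₂[-Real.sin α, Real.cos α] : Plane)‖ = 1 := by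
      rw [← sq_eq_sq₀ (norm_nonneg _) zero_le_one, norm_sq_eq]
      simp
    obtain ⟨b, hb⟩ := Orthonormal.exists_orthonormalBasis_extension_of_card_eq (𝕜 := ℝ)
      (E := Plane) (ι := Fin 2) (by simp) (v := fun _ => !₂[-Real.sin α, Real.cos α]) (s := {1})
      ⟨fun _ => hn, fun i j hij => (hij (Subsingleton.elim _ _)).elim⟩
    refine ⟨b, fun x => ?_⟩
    rw [OrthonormalBasis.repr_apply_apply, hb 1 rfl]
    simp [PiLp.inner_apply, cross]
    ring
  have hmp := (PiLp.volume_preserving_ofLp (Fin 2)).comp b.measurePreserving_repr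
  calc volume (strip R r α w)
      ≤ volume ((WithLp.ofLp ∘ b.repr) ⁻¹'
          Icc ![-R, cross α r - w] ![R, cross α r + w]) := by
        refine measure_mono fun q hq => ?_
        have h0 : |b.repr q 0| ≤ R :=
          ((Real.norm_eq_abs _).symm.le.trans (PiLp.norm_apply_le (b.repr q) 0)).trans
            (by rw [b.repr.norm_map]; exact hq.1)
        have h1 := hq.2
        rw [cross_sub, ← hb q, abs_le] at h1
        rw [abs_le] at h0
        simp only [mem_preimage, mem_Icc, Pi.le_def, Fin.forall_fin_two]
        simp
        refine ⟨⟨h0.1, ?_⟩, h0.2, ?_⟩ <;> linarith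
    _ = volume (Icc ![-R, cross α r - w] ![R, cross α r + w]) :=
        hmp.measure_preimage measurableSet_Icc.nullMeasurableSet
    _ = ENNReal.ofReal (4 * R * w) := by
        rw [Real.volume_Icc_pi, Fin.prod_univ_two, ← ENNReal.ofReal_mul (by simp; linarith)]
        congr 1
        simp
        ring

lemma volume_subregion_eq_zero {Ω : Set Plane} {R : ℝ} (hR : 0 ≤ R) (hΩ : ∀ q ∈ Ω, ‖q‖ ≤ R)
    (r : Plane) {α β : ℝ} (h : turn α β = 0) : volume (subregion Ω r α β) = 0 := by
  refine measure_mono_null (t := strip R r α 0) (fun q hq => ⟨hΩ q hq.1, ?_⟩)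
    (le_antisymm ((volume_strip_le hR r α).trans (by simp)) bot_le)
  obtain ⟨ψ, hψ, s, hs, hqs⟩ := mem_cone_iff_exists.1 (mem_subregion_iff.1 hq).2
  obtain rfl : ψ = 0 := le_antisymm (h ▸ hψ.2) hψ.1
  rw [hqs, cross_start_smul_dir]
  simp

lemma subregion_sdiff_subset {Ω : Set Plane} {R : ℝ} (hΩ : ∀ q ∈ Ω, ‖q‖ ≤ R)
    {r r' : Plane} (hr : ‖r‖ ≤ R) {α β α' β' w : ℝ}
    (hT : (turn α β ≤ Real.pi ∧ turn α' β' ≤ Real.pi) ∨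
      (Real.pi ≤ turn α β ∧ Real.pi ≤ turn α' β'))
    (hw : ‖r' - r‖ + 2 * R * |α' - α| ≤ w) (hw' : ‖r' - r‖ + 2 * R * |β' - β| ≤ w) :
    subregion Ω r α β \ subregion Ω r' α' β' ∪ subregion Ω r' α' β' \ subregion Ω r α β
      ⊆ strip R r α w ∪ strip R r β w := by
  intro q hq
  have hqΩ : q ∈ Ω := hq.elim (fun h => h.1.1) (fun h => h.1.1)
  by_contra hn
  simp only [strip, mem_union, mem_ofPred_eq, hΩ q hqΩ, true_and, not_or, not_le] at hn
  have := mem_cone_iff_of_abs_cross_sub_le hT hn.1 hn.2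
    ((abs_cross_sub_cross_le (hΩ q hqΩ) hr r' α α').trans hw)
    ((abs_cross_sub_cross_le (hΩ q hqΩ) hr r' β β').trans hw')
  simp only [mem_union, Set.mem_sdiff, mem_subregion_iff] at hq
  tauto

/-- Near a nondegenerate configuration, the subregions depend on it in a Lipschitz way. -/
lemma eventually_volume_subregion_sdiff_le {Ω : Set Plane} {R : ℝ} (hR : 0 ≤ R)
    (hΩ : ∀ q ∈ Ω, ‖q‖ ≤ R) {α β : ℝ} (h : turn α β ≠ 0) :
    ∀ᶠ x : ℝ × ℝ in 𝓝 (α, β), ∀ r r' : Plane, ‖r‖ ≤ R →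
      volume.real (subregion Ω r α β \ subregion Ω r' x.1 x.2) +
      volume.real (subregion Ω r' x.1 x.2 \ subregion Ω r α β) ≤
      16 * R * (1 + 2 * R) * (‖r' - r‖ + |x.1 - α| + |x.2 - β|) := by
  filter_upwards [eventually_turn_same_side h] with x hx r r' hr
  set w := (1 + 2 * R) * (‖r' - r‖ + |x.1 - α| + |x.2 - β|) with hw
  have h1 := norm_nonneg (r' - r)
  have h2 := abs_nonneg (x.1 - α)
  have h3 := abs_nonneg (x.2 - β)
  have hsub := subregion_sdiff_subset hΩ hr hx (w := w) (r' := r') (by nlinarith) (by nlinarith)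
  have hw0 : 0 ≤ w := by positivity
  -- Two strips of measure at most `4 * R * w` cover each of the two differences.
  have key : ∀ s ⊆ strip R r α w ∪ strip R r β w, volume.real s ≤ 8 * R * w := by
    intro s hs
    refine ENNReal.toReal_le_of_le_ofReal (by positivity) ?_
    calc volume s ≤ _ := measure_mono hs
      _ ≤ _ := measure_union_le _ _
      _ ≤ ENNReal.ofReal (4 * R * w) + ENNReal.ofReal (4 * R * w) :=
        add_le_add (volume_strip_le hR r α) (volume_strip_le hR r β)
      _ = ENNReal.ofReal (8 * R * w) := by
        rw [← ENNReal.ofReal_add (by positivity) (by positivity)]; ring_nf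
  have k1 := key _ (subset_union_left.trans hsub)
  have k2 := key _ (subset_union_right.trans hsub)
  calc _ ≤ 8 * R * w + 8 * R * w := add_le_add k1 k2
    _ = _ := by rw [hw]; ring

/-- The integral over `S ∩ S'` is common to both sides and cancels. -/
lemma norm_setIntegral_sub_setIntegral_le {X E : Type*} [MeasurableSpace X]
    [NormedAddCommGroup E] [NormedSpace ℝ E] {μ : Measure X} {g : X → E} {S S' : Set X} {M : ℝ}
    (hS : MeasurableSet S) (hS' : MeasurableSet S') (hμ : μ S < ⊤) (hμ' : μ S' < ⊤)
    (hg : IntegrableOn g S μ) (hg' : IntegrableOn g S' μ)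
    (hM : ∀ x ∈ S, ‖g x‖ ≤ M) (hM' : ∀ x ∈ S', ‖g x‖ ≤ M) :
    ‖(∫ x in S', g x ∂μ) - ∫ x in S, g x ∂μ‖ ≤ M * (μ.real (S \ S') + μ.real (S' \ S)) := by
  rw [← integral_inter_add_sdiff hS' hg, ← integral_inter_add_sdiff hS hg', inter_comm S' S,
    add_sub_add_left_eq_sub]
  refine (norm_sub_le _ _).trans ?_
  have h1 := norm_setIntegral_le_of_norm_le_const (μ := μ) (f := g) (C := M) (s := S \ S')
    ((measure_mono sdiff_subset).trans_lt hμ) (fun x hx => hM x hx.1)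
  have h2 := norm_setIntegral_le_of_norm_le_const (μ := μ) (f := g) (C := M) (s := S' \ S)
    ((measure_mono sdiff_subset).trans_lt hμ') (fun x hx => hM' x hx.1)
  linarith

/-! ### The gradient of the local cost -/

section Gradient

variable {Ω : Set Plane} {ρ : Plane → ℝ} {ρhigh : ℝ} {f : Plane → Plane → ℝ}

lemma aestronglyMeasurable_weighted {E : Type*} [NormedAddCommGroup E] [NormedSpace ℝ E]
    {g : Plane → Plane → E}
    (hΩ : IsCompact Ω) (hρm : Measurable ρ)
    (hg : ContinuousOn (fun z : Plane × Plane => g z.1 z.2) (univ ×ˢ Ω)) (p : Plane) :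
    AEStronglyMeasurable (fun q => ρ q • g p q) (volume.restrict Ω) := by
  refine hρm.aestronglyMeasurable.smul
    (ContinuousOn.aestronglyMeasurable_of_isCompact ?_ hΩ hΩ.measurableSet)
  exact hg.comp (f := fun q => (p, q)) (by fun_prop) (fun q hq => ⟨mem_univ _, hq⟩)

lemma exists_weighted_bound {E : Type*} [NormedAddCommGroup E] [NormedSpace ℝ E]
    {g : Plane → Plane → E} {K : Set Plane} (hK : IsCompact K) (hΩ : IsCompact Ω)
    (hρ : ∀ q ∈ Ω, |ρ q| ≤ ρhigh)
    (hg : ContinuousOn (fun z : Plane × Plane => g z.1 z.2) (univ ×ˢ Ω)) :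
    ∃ M, 0 ≤ M ∧ ∀ p ∈ K, ∀ q ∈ Ω, ‖ρ q • g p q‖ ≤ M := by
  obtain ⟨C, hC⟩ := (hK.prod hΩ).exists_bound_of_continuousOn
    (hg.mono (prod_mono (subset_univ _) subset_rfl))
  refine ⟨|ρhigh * C|, abs_nonneg _, fun p hp q hq => ?_⟩
  rw [norm_smul, Real.norm_eq_abs]
  refine (mul_le_mul (hρ q hq) (hC (p, q) ⟨hp, hq⟩) (norm_nonneg _)
    ((abs_nonneg _).trans (hρ q hq))).trans (le_abs_self _)

/-- Differentiation under the integral sign; compactness of the closed unit ball around `p` and of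
`Ω` gives a constant dominating function. -/
lemma hasGradientAt_setIntegral (hΩ : IsCompact Ω) (hρm : Measurable ρ)
    (hρ : ∀ q ∈ Ω, |ρ q| ≤ ρhigh)
    (hf : ContinuousOn (fun z : Plane × Plane => f z.1 z.2) (univ ×ˢ Ω))
    (hfd : ∀ q ∈ Ω, Differentiable ℝ (fun p => f p q))
    (hfg : ContinuousOn (fun z : Plane × Plane => gradient (fun p => f p z.2) z.1) (univ ×ˢ Ω))
    {S : Set Plane} (hS : MeasurableSet S) (hSΩ : S ⊆ Ω) (p : Plane) :
    HasGradientAt (fun p => ∫ q in S, f p q * ρ q)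
      (∫ q in S, ρ q • gradient (fun p => f p q) p) p := by
  have hvol : volume S ≠ ⊤ := ((measure_mono hSΩ).trans_lt hΩ.measure_lt_top).ne
  have hmono : volume.restrict S ≤ volume.restrict Ω := Measure.restrict_mono_set _ hSΩ
  have hfm : ∀ p, AEStronglyMeasurable (fun q => f p q * ρ q) (volume.restrict S) := by
    intro p
    simpa only [smul_eq_mul, mul_comm] using
      (aestronglyMeasurable_weighted hΩ hρm hf p).mono_measure hmono
  have hgm : AEStronglyMeasurable (fun q => ρ q • gradient (fun p => f p q) p)
      (volume.restrict S) :=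
    (aestronglyMeasurable_weighted (g := fun p q => gradient (fun p => f p q) p)
      hΩ hρm hfg p).mono_measure hmono
  obtain ⟨M, -, hM⟩ := exists_weighted_bound (isCompact_closedBall p 1) hΩ hρ
    (g := fun p q => gradient (fun p => f p q) p) hfg
  obtain ⟨M0, -, hM0⟩ := exists_weighted_bound (isCompact_closedBall p 1) hΩ hρ hf
  have key := hasFDerivAt_integral_of_dominated_of_fderiv_le (μ := volume.restrict S) (𝕜 := ℝ)
    (F := fun p q => f p q * ρ q) (x₀ := p)
    (F' := fun p q => InnerProductSpace.toDual ℝ Plane (ρ q • gradient (fun p => f p q) p))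
    (bound := fun _ => M) (Metric.closedBall_mem_nhds p one_pos)
    (Eventually.of_forall hfm)
    (by
      refine IntegrableOn.of_bound hvol.lt_top (hfm p) M0 ((ae_restrict_iff' hS).2 ?_)
      refine Eventually.of_forall fun q hq => ?_
      simpa [mul_comm] using hM0 p (Metric.mem_closedBall_self zero_le_one) q (hSΩ hq))
    ((InnerProductSpace.toDual ℝ Plane).continuous.comp_aestronglyMeasurable hgm)
    ((ae_restrict_iff' hS).2 (Eventually.of_forall fun q hq x hx => by
      rw [LinearIsometryEquiv.norm_map]; exact hM x hx q (hSΩ hq)))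
    (integrableOn_const hvol)
    ((ae_restrict_iff' hS).2 (Eventually.of_forall fun q hq x _ => by
      have h := (hfd q (hSΩ hq) x).hasGradientAt.hasFDerivAt.mul_const (ρ q)
      simpa only [map_smulₛₗ, conj_trivial] using h))
  rw [hasGradientAt_iff_hasFDerivAt]
  convert! key using 1
  exact ((InnerProductSpace.toDual ℝ Plane).toContinuousLinearEquiv.integral_comp_comm _).symm

/-- The gradient of the local cost depends on the configuration at most as the subregion does. -/
lemma exists_norm_gradient_localCost_sub_le (hΩ : IsCompact Ω) (hρm : Measurable ρ)
    (hρ : ∀ q ∈ Ω, |ρ q| ≤ ρhigh)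
    (hf : ContinuousOn (fun z : Plane × Plane => f z.1 z.2) (univ ×ˢ Ω))
    (hfd : ∀ q ∈ Ω, Differentiable ℝ (fun p => f p q))
    (hfg : ContinuousOn (fun z : Plane × Plane => gradient (fun p => f p z.2) z.1) (univ ×ˢ Ω)) :
    ∃ M, 0 ≤ M ∧ ∀ p ∈ Ω, ∀ (r : Plane) (α β : ℝ) (r' : Plane) (α' β' : ℝ),
      ‖gradient (localCost Ω ρ f r' α' β') p - gradient (localCost Ω ρ f r α β) p‖ ≤
        M * (volume.real (subregion Ω r α β \ subregion Ω r' α' β') +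
          volume.real (subregion Ω r' α' β' \ subregion Ω r α β)) := by
  obtain ⟨M, hM0, hM⟩ := exists_weighted_bound hΩ hΩ hρ
    (g := fun p q => gradient (fun p => f p q) p) hfg
  refine ⟨M, hM0, fun p hp r α β r' α' β' => ?_⟩
  have hm := fun r α β => measurableSet_subregion hΩ.measurableSet r α β
  have hs := fun r α β => subregion_subset Ω r α β
  have hgrad : ∀ r α β, gradient (localCost Ω ρ f r α β) p
      = ∫ q in subregion Ω r α β, ρ q • gradient (fun p => f p q) p := fun r α β =>
    (hasGradientAt_setIntegral hΩ hρm hρ hf hfd hfg (hm r α β) (hs r α β) p).gradient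
  have hint : IntegrableOn (fun q => ρ q • gradient (fun p => f p q) p) Ω volume :=
    IntegrableOn.of_bound hΩ.measure_lt_top
      (aestronglyMeasurable_weighted (g := fun p q => gradient (fun p => f p q) p) hΩ hρm hfg p) M
      ((ae_restrict_iff' hΩ.measurableSet).2 (Eventually.of_forall fun q hq => hM p hp q hq))
  have hv := fun r α β => (measure_mono (μ := volume) (hs r α β)).trans_lt hΩ.measure_lt_top
  rw [hgrad, hgrad]
  exact norm_setIntegral_sub_setIntegral_le (hm _ _ _) (hm _ _ _) (hv _ _ _) (hv _ _ _)
    (hint.mono_set (hs _ _ _)) (hint.mono_set (hs _ _ _))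
    (fun q hq => hM p hp q (hs _ _ _ hq)) (fun q hq => hM p hp q (hs _ _ _ hq))

end Gradient

/-! ### Consequences of a nonsingular Hessian -/

lemma differentiableAt_and_norm_le_of_rank_eq_two {g : Plane → Plane} {p : Plane} {C : ℝ}
    (hrank : (fderiv ℝ g p).rank = 2) (hC : ‖(fderiv ℝ g p).inverse‖ ≤ C) :
    DifferentiableAt ℝ g p ∧ ∀ v, ‖v‖ ≤ C * ‖fderiv ℝ g p v‖ := by
  set H := fderiv ℝ g p with hH
  refine ⟨?_, ?_⟩
  -- `fderiv` defaults to 0 where `g` is not differentiable, and 0 does not have rank 2.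
  · by_contra h
    rw [hH, fderiv_zero_of_not_differentiableAt h] at hrank
    simp at hrank
  · have hsurj : Function.Surjective H := by
      rw [← ContinuousLinearMap.coe_coe, ← LinearMap.range_eq_top]
      apply Submodule.eq_top_of_finrank_eq
      have : Module.finrank ℝ (LinearMap.range (H : Plane →ₗ[ℝ] Plane)) = 2 := by
        rw [Module.finrank, ← LinearMap.rank, hrank]; simp
      rw [this]; simp
    have hinj : Function.Injective H := (LinearMap.injective_iff_surjective
      (f := (H : Plane →ₗ[ℝ] Plane))).2 hsurj
    -- `inverse` defaults to 0 on noninvertible maps, so its norm bound is informative only once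
    -- invertibility is known.
    have hinv : H.IsInvertible :=
      ⟨(LinearEquiv.ofBijective (H : Plane →ₗ[ℝ] Plane) ⟨hinj, hsurj⟩).toContinuousLinearEquiv, by
        ext v; rfl⟩
    intro v
    calc ‖v‖ = ‖H.inverse (H v)‖ := by rw [hinv.inverse_apply_self]
      _ ≤ ‖H.inverse‖ * ‖H v‖ := H.inverse.le_opNorm _
      _ ≤ C * ‖H v‖ := by gcongr

/-- At turn 0 the subregion is null, so the cost and its Hessian vanish identically. This excludes
the configurations at which `turn` may jump. -/
lemma turn_ne_zero_of_rank_hessian {Ω : Set Plane} {R : ℝ} (hR : 0 ≤ R) (hΩ : ∀ q ∈ Ω, ‖q‖ ≤ R)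
    {ρ : Plane → ℝ} {f : Plane → Plane → ℝ} {r p : Plane} {α β : ℝ}
    (h : (hessian Ω ρ f r α β p).rank = 2) : turn α β ≠ 0 := by
  intro h0
  have hv := volume_subregion_eq_zero hR hΩ r h0
  have hc : localCost Ω ρ f r α β = fun _ => 0 := by
    funext p
    rw [localCost, Measure.restrict_eq_zero.2 hv, integral_zero_measure]
  have hz : hessian Ω ρ f r α β p = 0 := by
    rw [hessian, hc, gradient_fun_const']
    simp
  rw [hz] at h
  simp at h

/-! ### Tracking by a proportional control -/

section Relaxation

variable {E : Type*} [NormedAddCommGroup E] [NormedSpace ℝ E]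

lemma norm_sub_le_of_relaxation {κ δ a b : ℝ} (hκ : 0 < κ) (hab : a ≤ b) {p x : ℝ → E} {z : E}
    (hpc : ContinuousOn p (Icc a b))
    (hp : ∀ t ∈ Ico a b, HasDerivWithinAt p (-κ • (p t - x t)) (Ici t) t)
    (hx : ∀ t ∈ Icc a b, ‖x t - z‖ ≤ δ) :
    ‖p b - z‖ ≤ Real.exp (-(κ * (b - a))) * ‖p a - z‖ + δ := by
  have hδ : 0 ≤ δ := (norm_nonneg _).trans (hx a ⟨le_rfl, hab⟩)
  have hexp : ∀ t, HasDerivAt (fun t => Real.exp (κ * (t - a))) (κ * Real.exp (κ * (t - a))) t := by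
    intro t
    have := (((hasDerivAt_id t).sub_const a).const_mul κ).exp
    simpa [mul_comm] using this
  -- With the integrating factor `exp (κ * (t - a))`, the derivative of the weighted error involves
  -- only `x t - z`.
  have key := image_norm_le_of_norm_deriv_right_le_deriv_boundary' (a := a) (b := b)
    (f := fun t => Real.exp (κ * (t - a)) • (p t - z))
    (f' := fun t => (κ * Real.exp (κ * (t - a))) • (x t - z))
    (B := fun t => ‖p a - z‖ + δ * (Real.exp (κ * (t - a)) - 1))
    (B' := fun t => δ * (κ * Real.exp (κ * (t - a))))
    (ContinuousOn.smul (by fun_prop) (hpc.sub continuousOn_const))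
    (fun t ht => by
      convert! ((hexp t).hasDerivWithinAt (s := Ici t)).smul ((hp t ht).sub_const z) using 1
      module)
    (by simp) (by fun_prop)
    (fun t _ => ((((hexp t).sub_const 1).const_mul δ).const_add _).hasDerivWithinAt)
    (fun t ht => by
      rw [norm_smul, Real.norm_of_nonneg (by positivity), mul_comm δ]
      gcongr
      exact hx t ⟨ht.1, ht.2.le⟩)
    (right_mem_Icc.2 hab)
  simp only [norm_smul, Real.norm_eq_abs, Real.abs_exp] at key
  have hmul := mul_le_mul_of_nonneg_left key (Real.exp_nonneg (-(κ * (b - a))))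
  rw [← mul_assoc, ← Real.exp_add, neg_add_cancel, Real.exp_zero, one_mul] at hmul
  have h1 : Real.exp (-(κ * (b - a))) * Real.exp (κ * (b - a)) = 1 := by
    rw [← Real.exp_add, neg_add_cancel, Real.exp_zero]
  have h2 := Real.exp_pos (-(κ * (b - a)))
  nlinarith [mul_nonneg hδ h2.le]

/-- A proportional control tracks a bounded target that varies ever more slowly. -/
lemma tendsto_norm_sub_of_relaxation {κ R : ℝ} (hκ : 0 < κ) {p x : ℝ → E}
    (hp : ∀ t, 0 ≤ t → HasDerivWithinAt p (-κ • (p t - x t)) (Ici 0) t)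
    (hx : ∀ t, 0 ≤ t → ‖x t‖ ≤ R)
    (hslow : ∀ T, ∀ ε > 0, ∀ᶠ τ in atTop, ∀ t ∈ Icc τ (τ + T), ‖x t - x τ‖ ≤ ε) :
    Tendsto (fun t => ‖p t - x t‖) atTop (𝓝 0) := by
  have hpc : ContinuousOn p (Ici 0) := fun t ht => (hp t ht).continuousWithinAt
  have hest : ∀ a b δ : ℝ, ∀ z : E, 0 ≤ a → a ≤ b → (∀ t ∈ Icc a b, ‖x t - z‖ ≤ δ) →
      ‖p b - z‖ ≤ Real.exp (-(κ * (b - a))) * ‖p a - z‖ + δ := by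
    intro a b δ z ha hab h
    exact norm_sub_le_of_relaxation hκ hab (hpc.mono fun t ht => ha.trans ht.1)
      (fun t ht => (hp t (ha.trans ht.1)).mono (Ici_subset_Ici.2 (ha.trans ht.1))) h
  have hpb : ∀ t, 0 ≤ t → ‖p t‖ ≤ ‖p 0‖ + R := by
    intro t ht
    have h := hest 0 t R 0 le_rfl ht (fun s hs => by simpa using hx s hs.1)
    simp only [sub_zero] at h
    have h1 : Real.exp (-(κ * t)) ≤ 1 := Real.exp_le_one_iff.2 (by nlinarith)
    nlinarith [norm_nonneg (p 0)]
  set B := ‖p 0‖ + R + R with hB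
  have hB0 : 0 ≤ B := by
    have := (norm_nonneg _).trans (hx 0 le_rfl)
    positivity
  rw [Metric.tendsto_atTop]
  intro ε hε
  -- The window length is fixed first, so that the initial error decays below `ε / 3`; the starting
  -- time comes after it, so late that the target drifts by at most `ε / 3`.
  have hT : ∃ T, 0 ≤ T ∧ Real.exp (-(κ * T)) * B < ε / 3 := by
    have h : Tendsto (fun T => Real.exp (-(κ * T)) * B) atTop (𝓝 (0 * B)) :=
      (Real.tendsto_exp_neg_atTop_nhds_zero.comp (tendsto_id.const_mul_atTop hκ)).mul_const B
    rw [zero_mul] at h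
    exact ((eventually_ge_atTop 0).and (h.eventually_lt_const (by positivity))).exists
  obtain ⟨T, hT0, hT⟩ := hT
  obtain ⟨τ₀, hτ₀⟩ := eventually_atTop.1 (hslow T (ε / 3) (by positivity))
  refine ⟨max τ₀ 0 + T, fun t ht => ?_⟩
  have h1 : max τ₀ 0 ≤ t - T := by linarith
  have h0 : 0 ≤ t - T := (le_max_right _ _).trans h1
  have h2 := hτ₀ (t - T) ((le_max_left _ _).trans h1)
  rw [sub_add_cancel] at h2
  have h3 := hest (t - T) t (ε / 3) (x (t - T)) h0 (by linarith) h2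
  have h4 := h2 t ⟨by linarith, le_rfl⟩
  have h5 : ‖p (t - T) - x (t - T)‖ ≤ B :=
    (norm_sub_le _ _).trans (add_le_add (hpb _ h0) (hx _ h0))
  have h6 : Real.exp (-(κ * T)) * ‖p (t - T) - x (t - T)‖ ≤ Real.exp (-(κ * T)) * B := by gcongr
  rw [sub_sub_cancel] at h3
  rw [dist_zero_right, norm_norm]
  have h7 : p t - x t = (p t - x (t - T)) - (x t - x (t - T)) := by abel
  rw [h7]
  linarith [norm_sub_le (p t - x (t - T)) (x t - x (t - T))]

end Relaxation

/-! ### Displacement over bounded time windows -/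

section SlowVariation

variable {E : Type*} [NormedAddCommGroup E]

/-- If the squared speed of `x` is dominated by the decay rate of `V`, then the displacement
of `x` is controlled by the decrease of `V`, up to an arbitrarily small drift. -/
lemma norm_sub_le_of_speed_sq_le {x : ℝ → E} {V W σ : ℝ → ℝ} {D ε τ t : ℝ} (hε : 0 < ε)
    (hτ : 0 ≤ τ) (hτt : τ ≤ t)
    (hxc : ContinuousOn x (Ici 0))
    (hx : ∀ t, 0 ≤ t → ∀ s, σ t < s → ∀ᶠ z in 𝓝[>] t, ‖x z - x t‖ < s * (z - t))
    (hV : ∀ t, 0 ≤ t → HasDerivWithinAt V (-W t) (Ici 0) t)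
    (hσ : ∀ t, 0 ≤ t → σ t ^ 2 ≤ D * W t) :
    ‖x t - x τ‖ ≤ D / ε * (V τ - V t) + ε * (t - τ) := by
  have hsub : Icc τ t ⊆ Ici 0 := fun s hs => hτ.trans hs.1
  -- Since `x` is not assumed differentiable, only its upper right slope is compared with the
  -- derivative of the bound.
  refine image_norm_le_of_liminf_right_slope_norm_lt_deriv_boundary (a := τ) (b := t)
    (f := fun s => x s - x τ) (f' := σ)
    (B := fun s => D / ε * (V τ - V s) + ε * (s - τ)) (B' := fun s => D / ε * W s + ε)
    ((hxc.mono hsub).sub continuousOn_const) ?_ (by simp) ?_ ?_ ?_ (right_mem_Icc.2 hτt)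
  · intro s hs c hc
    refine Eventually.frequently ?_
    filter_upwards [hx s (hτ.trans hs.1) c hc, self_mem_nhdsWithin] with z hz hzs
    have hzs' : 0 < z - s := sub_pos.2 hzs
    rw [slope_def_field, div_lt_iff₀ hzs']
    refine lt_of_le_of_lt ?_ hz
    refine (norm_sub_norm_le _ _).trans_eq ?_
    simp
  · have hVc : ContinuousOn V (Icc τ t) := fun s hs =>
      (hV s (hτ.trans hs.1)).continuousWithinAt.mono hsub
    exact ((continuousOn_const.sub hVc).const_mul _).add (by fun_prop)
  · intro s hs
    have h0 := hτ.trans hs.1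
    have h1 := ((hV s h0).mono (Ici_subset_Ici.2 h0)).const_sub (V τ)
    have h2 := ((hasDerivAt_id s).sub_const τ).hasDerivWithinAt (s := Ici s)
    exact ((h1.const_mul (D / ε)).add (h2.const_mul ε)).congr_deriv (by simp)
  · intro s hs _
    have h := hσ s (hτ.trans hs.1)
    have h' : σ s ^ 2 / ε ≤ D / ε * W s := by
      rw [div_mul_eq_mul_div]; gcongr
    -- AM–GM in a strict form, as the comparison principle requires.
    have h2 : σ s < σ s ^ 2 / ε + ε := by
      rw [← sub_pos]
      have : σ s ^ 2 / ε + ε - σ s = ((σ s - ε / 2) ^ 2 + 3 / 4 * ε ^ 2) / ε := by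
        field_simp; ring
      rw [this]
      positivity
    linarith

/-- `V` is nonincreasing and bounded below, so its remaining decrease tends to 0. The drift weight
is fixed beforehand from `T` and `ε`. -/
lemma eventually_norm_sub_le_of_speed_sq_le {x : ℝ → E} {V W σ : ℝ → ℝ} {D : ℝ}
    (hD : 0 ≤ D) (hxc : ContinuousOn x (Ici 0))
    (hx : ∀ t, 0 ≤ t → ∀ s, σ t < s → ∀ᶠ z in 𝓝[>] t, ‖x z - x t‖ < s * (z - t))
    (hV0 : ∀ t, 0 ≤ V t) (hV : ∀ t, 0 ≤ t → HasDerivWithinAt V (-W t) (Ici 0) t)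
    (hW : ∀ t, 0 ≤ t → 0 ≤ W t)
    (hσ : ∀ t, 0 ≤ t → σ t ^ 2 ≤ D * W t) :
    ∀ T, ∀ ε > 0, ∀ᶠ τ in atTop, ∀ t ∈ Icc τ (τ + T), ‖x t - x τ‖ ≤ ε := by
  intro T ε hε
  have hanti : AntitoneOn V (Ici 0) := by
    refine antitoneOn_of_hasDerivWithinAt_nonpos (f' := fun t => -W t) (convex_Ici 0)
      (fun t ht => (hV t ht).continuousWithinAt) (fun t ht => ?_) (fun t ht => ?_)
    · exact (hV t (interior_subset ht)).mono interior_subset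
    · exact neg_nonpos.2 (hW t (interior_subset ht))
  obtain ⟨l, hl⟩ : ∃ l, Tendsto V atTop (𝓝 l) := by
    have hanti' : Antitone fun t => V (max t 0) := fun s t hst =>
      hanti (mem_Ici.2 (le_max_right _ _)) (mem_Ici.2 (le_max_right _ _)) (max_le_max_right _ hst)
    have h := tendsto_atTop_ciInf hanti' ⟨0, by rintro _ ⟨t, rfl⟩; exact hV0 _⟩
    refine ⟨_, h.congr' ?_⟩
    filter_upwards [eventually_ge_atTop 0] with t ht
    rw [max_eq_left ht]
  set η := ε / (2 * (|T| + 1)) with hη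
  have hη0 : 0 < η := by positivity
  have hηT : η * |T| ≤ ε / 2 := by
    rw [hη, div_mul_eq_mul_div, div_le_div_iff₀ (by positivity) (by positivity)]
    nlinarith [abs_nonneg T]
  have hlge : ∀ t, 0 ≤ t → l ≤ V t := fun t ht => by
    refine le_of_tendsto hl ?_
    filter_upwards [eventually_ge_atTop t] with s hs
    exact hanti ht (ht.trans hs) hs
  have hlim : Tendsto (fun τ => D / η * (V τ - l)) atTop (𝓝 0) := by
    simpa using (hl.sub_const l).const_mul (D / η)
  filter_upwards [hlim.eventually_lt_const (half_pos hε), eventually_ge_atTop 0] with τ h1 hτ t ht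
  have h2 := norm_sub_le_of_speed_sq_le hη0 hτ ht.1 hxc hx hV hσ
  have h3 : D / η * (V τ - V t) ≤ D / η * (V τ - l) := by
    gcongr
    exact hlge t (hτ.trans ht.1)
  have h4 : η * (t - τ) ≤ η * |T| := by
    gcongr
    linarith [ht.2, le_abs_self T]
  linarith

end SlowVariation

/-! ### Displacement of a zero -/

/-- A quantitative implicit function estimate at a single point: a moving zero is displaced in
proportion to the perturbation if the derivative is bounded below there. -/
lemma eventually_norm_sub_le_of_fderiv_bound {E F ι : Type*} [NormedAddCommGroup E]
    [NormedSpace ℝ E] [NormedAddCommGroup F] [NormedSpace ℝ F] {l : Filter ι} {G : E → F}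
    {H : E →L[ℝ] F} {x₀ : E} {x : ι → E} {d : ι → ℝ} {C : ℝ} (hC : 0 ≤ C)
    (hG : HasFDerivAt G H x₀) (hH : ∀ v, ‖v‖ ≤ C * ‖H v‖) (h0 : G x₀ = 0)
    (hx : Tendsto x l (𝓝 x₀)) (hd : ∀ᶠ z in l, ‖G (x z)‖ ≤ d z) :
    ∀ᶠ z in l, ‖x z - x₀‖ ≤ 2 * C * d z := by
  -- This constant makes `C` times the linearization error at most half of `‖x z - x₀‖`, to be
  -- absorbed on the left; the `+ 1` covers `C = 0`.
  have ho := hx.eventually (hG.isLittleO.def (c := 1 / (2 * (C + 1))) (by positivity))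
  filter_upwards [ho, hd] with z h1 h2
  rw [h0, sub_zero] at h1
  have h3 := hH (x z - x₀)
  have h4 : ‖H (x z - x₀)‖ ≤ d z + 1 / (2 * (C + 1)) * ‖x z - x₀‖ := by
    have : H (x z - x₀) = G (x z) - (G (x z) - H (x z - x₀)) := by abel
    rw [this]
    exact (norm_sub_le _ _).trans (add_le_add h2 h1)
  have h5 : C * (1 / (2 * (C + 1)) * ‖x z - x₀‖) ≤ 1 / 2 * ‖x z - x₀‖ := by
    rw [← mul_assoc]
    gcongr
    rw [mul_one_div, div_le_div_iff₀ (by positivity) (by positivity)]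
    linarith
  nlinarith [mul_le_mul_of_nonneg_left h4 hC]

/-! ### Energy dissipation of the partition dynamics -/

section Energy

variable {N : ℕ} [NeZero N]

/-- Summation by parts on the cycle; it produces the discrete Laplacian that appears in the
dynamics. -/
lemma sum_inner_sub_succ {E : Type*} [NormedAddCommGroup E] [InnerProductSpace ℝ E]
    (x y : Fin N → E) :
    ∑ i, inner ℝ (x i - x (i + 1)) (y i - y (i + 1))
      = ∑ i, inner ℝ ((2 : ℝ) • x i - x (i - 1) - x (i + 1)) (y i) := by
  have h : ∑ i, inner ℝ (x i - x (i + 1)) (y (i + 1)) = ∑ i, inner ℝ (x (i - 1) - x i) (y i) := by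
    rw [← Equiv.sum_comp (Equiv.addRight (1 : Fin N))
      (fun i => inner ℝ (x (i - 1) - x i) (y i))]
    simp
  simp_rw [inner_sub_right, Finset.sum_sub_distrib]
  rw [h, ← Finset.sum_sub_distrib]
  refine Finset.sum_congr rfl fun i _ => ?_
  rw [← inner_sub_left]
  congr 1
  module

lemma fderiv_apply_eq_partials {F : Plane × ℝ × ℝ → ℝ} {x : Plane} {a b : ℝ}
    (h : DifferentiableAt ℝ F (x, a, b)) (v : Plane) (s t : ℝ) :
    fderiv ℝ F (x, a, b) (v, s, t) = inner ℝ (gradient (fun y => F (y, a, b)) x) v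
      + deriv (fun c => F (x, c, b)) a * s + deriv (fun c => F (x, a, c)) b * t := by
  set H := fderiv ℝ F (x, a, b) with hH
  have hF : HasFDerivAt F H (x, a, b) := h.hasFDerivAt
  have h1 : HasFDerivAt (fun y => F (y, a, b))
      (H.comp (ContinuousLinearMap.inl ℝ Plane (ℝ × ℝ))) x :=
    HasFDerivAt.comp x (f := fun y => (y, a, b)) hF (hasFDerivAt_prodMk_left x (a, b))
  have h2 : HasDerivAt (fun c => F (x, c, b)) (H (0, 1, 0)) a :=
    HasFDerivAt.comp_hasDerivAt a (f := fun c => (x, c, b)) hF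
      ((hasDerivAt_const a x).prodMk ((hasDerivAt_id a).prodMk (hasDerivAt_const a b)))
  have h3 : HasDerivAt (fun c => F (x, a, c)) (H (0, 0, 1)) b :=
    HasFDerivAt.comp_hasDerivAt b (f := fun c => (x, a, c)) hF
      ((hasDerivAt_const b x).prodMk ((hasDerivAt_const b a).prodMk (hasDerivAt_id b)))
  have hv : inner ℝ (gradient (fun y => F (y, a, b)) x) v = H (v, 0, 0) := by
    rw [gradient, InnerProductSpace.toDual_symm_apply, h1.fderiv]
    rfl
  rw [h2.deriv, h3.deriv, hv]
  have : (v, s, t) = (v, (0 : ℝ), (0 : ℝ)) + s • ((0 : Plane), (1 : ℝ), (0 : ℝ))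
      + t • ((0 : Plane), (0 : ℝ), (1 : ℝ)) := by
    ext <;> simp
  rw [this, map_add, map_add, map_smul, map_smul]
  simp [mul_comm]

/-- The velocity of the phase `φ i` under the partition dynamics. -/
noncomputable def phaseVel (Ω : Set Plane) (ρ : Plane → ℝ) (κφ : ℝ) (φ : Fin N → ℝ → ℝ)
    (r : Fin N → ℝ → Plane) (i : Fin N) (t : ℝ) : ℝ :=
  -κφ *
      ((2 * m Ω ρ φ r i t - m Ω ρ φ r (i - 1) t - m Ω ρ φ r (i + 1) t) * dmOwn Ω ρ φ r i t
        + (2 * m Ω ρ φ r (i - 1) t - m Ω ρ φ r (i - 2) t - m Ω ρ φ r i t)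
            * dmNext Ω ρ φ r (i - 1) t)

/-- The velocity of the reference point `r i` under the partition dynamics. -/
noncomputable def refVel (Ω : Set Plane) (ρ : Plane → ℝ) (κr : ℝ) (φ : Fin N → ℝ → ℝ)
    (r : Fin N → ℝ → Plane) (i : Fin N) (t : ℝ) : Plane :=
  -κr •
      ((2 * m Ω ρ φ r i t - m Ω ρ φ r (i - 1) t - m Ω ρ φ r (i + 1) t) • dmRef Ω ρ φ r i t
        + ((2 : ℝ) • r i t - r (i - 1) t - r (i + 1) t))

/-- The disagreement of the workloads and of the reference points. -/
noncomputable def energy (Ω : Set Plane) (ρ : Plane → ℝ) (φ : Fin N → ℝ → ℝ)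
    (r : Fin N → ℝ → Plane) (t : ℝ) : ℝ :=
  1 / 2 * (∑ i, (m Ω ρ φ r i t - m Ω ρ φ r (i + 1) t) ^ 2 + ∑ i, ‖r i t - r (i + 1) t‖ ^ 2)

/-- The decay rate of the energy under the partition dynamics. -/
noncomputable def dissipation (Ω : Set Plane) (ρ : Plane → ℝ) (κφ κr : ℝ) (φ : Fin N → ℝ → ℝ)
    (r : Fin N → ℝ → Plane) (t : ℝ) : ℝ :=
  ∑ i, phaseVel Ω ρ κφ φ r i t ^ 2 / κφ + ∑ i, ‖refVel Ω ρ κr φ r i t‖ ^ 2 / κr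

variable {Ω : Set Plane} {ρ : Plane → ℝ} {κφ κr : ℝ} {φ : Fin N → ℝ → ℝ} {r : Fin N → ℝ → Plane}

lemma energy_nonneg (t : ℝ) : 0 ≤ energy Ω ρ φ r t := by
  unfold energy; positivity

lemma dissipation_nonneg (hκφ : 0 < κφ) (hκr : 0 < κr) (t : ℝ) :
    0 ≤ dissipation Ω ρ κφ κr φ r t := by
  unfold dissipation; positivity

lemma phaseVel_sq_le (hκφ : 0 < κφ) (hκr : 0 < κr) (i : Fin N) (t : ℝ) :
    phaseVel Ω ρ κφ φ r i t ^ 2 ≤ κφ * dissipation Ω ρ κφ κr φ r t := by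
  rw [← div_le_iff₀' hκφ]
  refine (Finset.single_le_sum (f := fun i => phaseVel Ω ρ κφ φ r i t ^ 2 / κφ)
    (fun j _ => by positivity) (Finset.mem_univ i)).trans ?_
  exact le_add_of_nonneg_right (by positivity)

lemma norm_refVel_sq_le (hκφ : 0 < κφ) (hκr : 0 < κr) (i : Fin N) (t : ℝ) :
    ‖refVel Ω ρ κr φ r i t‖ ^ 2 ≤ κr * dissipation Ω ρ κφ κr φ r t := by
  rw [← div_le_iff₀' hκr]
  refine (Finset.single_le_sum (f := fun i => ‖refVel Ω ρ κr φ r i t‖ ^ 2 / κr)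
    (fun j _ => by positivity) (Finset.mem_univ i)).trans ?_
  exact le_add_of_nonneg_left (by positivity)

lemma IsPartitionTrajectory.hasDerivWithinAt_m (h : IsPartitionTrajectory Ω ρ κφ κr φ r)
    {t : ℝ} (ht : 0 ≤ t) (i : Fin N) :
    HasDerivWithinAt (m Ω ρ φ r i)
      (inner ℝ (dmRef Ω ρ φ r i t) (refVel Ω ρ κr φ r i t)
        + dmOwn Ω ρ φ r i t * phaseVel Ω ρ κφ φ r i t
        + dmNext Ω ρ φ r i t * phaseVel Ω ρ κφ φ r (i + 1) t) (Ici 0) t := by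
  have hd := h.differentiable t ht i
  have hc := hd.hasFDerivAt.comp_hasDerivWithinAt t (s := Ici 0)
    (f := fun s => (r i s, φ i s, φ (i + 1) s))
    ((h.reference t ht i).prodMk ((h.phase t ht i).prodMk (h.phase t ht (i + 1))))
  rw [fderiv_apply_eq_partials hd] at hc
  exact hc

/-- The bracket in each velocity is the corresponding partial gradient of the energy, so every
component contributes minus its squared speed divided by its gain. -/
lemma IsPartitionTrajectory.hasDerivWithinAt_energy (h : IsPartitionTrajectory Ω ρ κφ κr φ r)
    (hκφ : 0 < κφ) (hκr : 0 < κr) {t : ℝ} (ht : 0 ≤ t) :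
    HasDerivWithinAt (energy Ω ρ φ r) (-dissipation Ω ρ κφ κr φ r t) (Ici 0) t := by
  set dm : Fin N → ℝ := fun i => inner ℝ (dmRef Ω ρ φ r i t) (refVel Ω ρ κr φ r i t)
        + dmOwn Ω ρ φ r i t * phaseVel Ω ρ κφ φ r i t
        + dmNext Ω ρ φ r i t * phaseVel Ω ρ κφ φ r (i + 1) t with hdm
  have hm : ∀ i, HasDerivWithinAt (m Ω ρ φ r i) (dm i) (Ici 0) t := fun i =>
    h.hasDerivWithinAt_m ht i
  have hr : ∀ i, HasDerivWithinAt (r i) (refVel Ω ρ κr φ r i t) (Ici 0) t := h.reference t ht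
  have h1 : HasDerivWithinAt
      (fun t => ∑ i, (m Ω ρ φ r i t - m Ω ρ φ r (i + 1) t) ^ 2)
      (∑ i, 2 * ((m Ω ρ φ r i t - m Ω ρ φ r (i + 1) t) * (dm i - dm (i + 1)))) (Ici 0) t := by
    refine HasDerivWithinAt.fun_sum fun i _ => ?_
    exact (((hm i).sub (hm (i + 1))).pow 2).congr_deriv (by simp [mul_assoc])
  have h2 : HasDerivWithinAt (fun t => ∑ i, ‖r i t - r (i + 1) t‖ ^ 2)
      (∑ i, 2 * inner ℝ (r i t - r (i + 1) t)
        (refVel Ω ρ κr φ r i t - refVel Ω ρ κr φ r (i + 1) t)) (Ici 0) t :=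
    HasDerivWithinAt.fun_sum fun i _ => ((hr i).sub (hr (i + 1))).norm_sq
  have h3 := (h1.add h2).const_mul (1 / 2)
  refine h3.congr_deriv ?_
  have e1 : ∑ i, (m Ω ρ φ r i t - m Ω ρ φ r (i + 1) t) * (dm i - dm (i + 1))
      = ∑ i, (2 * m Ω ρ φ r i t - m Ω ρ φ r (i - 1) t - m Ω ρ φ r (i + 1) t) * dm i := by
    simpa [mul_comm] using sum_inner_sub_succ (fun i => m Ω ρ φ r i t) dm
  -- An index shift collects at `φ i` the contributions of both workloads that it bounds, `m i` and
  -- `m (i - 1)`.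
  have e2 : ∑ i, (2 * m Ω ρ φ r i t - m Ω ρ φ r (i - 1) t - m Ω ρ φ r (i + 1) t) *
        (dmNext Ω ρ φ r i t * phaseVel Ω ρ κφ φ r (i + 1) t)
      = ∑ i, (2 * m Ω ρ φ r (i - 1) t - m Ω ρ φ r (i - 2) t - m Ω ρ φ r i t) *
        (dmNext Ω ρ φ r (i - 1) t * phaseVel Ω ρ κφ φ r i t) := by
    rw [← Equiv.sum_comp (Equiv.addRight (1 : Fin N)) (fun i =>
      (2 * m Ω ρ φ r (i - 1) t - m Ω ρ φ r (i - 2) t - m Ω ρ φ r i t) *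
        (dmNext Ω ρ φ r (i - 1) t * phaseVel Ω ρ κφ φ r i t))]
    refine Finset.sum_congr rfl fun i _ => ?_
    have : i + 1 - 2 = i - 1 := by
      have h2 : (2 : Fin N) = 1 + 1 := Fin.ext (by simp [Fin.val_add])
      rw [h2, add_sub_add_right_eq_sub]
    simp [this]
  have e3 : ∀ i, phaseVel Ω ρ κφ φ r i t ^ 2 / κφ =
      -(((2 * m Ω ρ φ r i t - m Ω ρ φ r (i - 1) t - m Ω ρ φ r (i + 1) t) * dmOwn Ω ρ φ r i t
        + (2 * m Ω ρ φ r (i - 1) t - m Ω ρ φ r (i - 2) t - m Ω ρ φ r i t)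
            * dmNext Ω ρ φ r (i - 1) t) * phaseVel Ω ρ κφ φ r i t) := by
    intro i
    rw [div_eq_iff hκφ.ne', sq]
    nth_rewrite 1 [phaseVel]
    ring
  have e4 : ∀ i, ‖refVel Ω ρ κr φ r i t‖ ^ 2 / κr =
      -inner ℝ ((2 * m Ω ρ φ r i t - m Ω ρ φ r (i - 1) t - m Ω ρ φ r (i + 1) t)
        • dmRef Ω ρ φ r i t + ((2 : ℝ) • r i t - r (i - 1) t - r (i + 1) t))
        (refVel Ω ρ κr φ r i t) := by
    intro i
    rw [div_eq_iff hκr.ne', ← real_inner_self_eq_norm_sq]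
    nth_rewrite 1 [refVel]
    rw [inner_smul_left]
    simp
    ring
  rw [← Finset.mul_sum, ← Finset.mul_sum, ← mul_add, ← mul_assoc, e1, sum_inner_sub_succ,
    dissipation]
  simp_rw [e3, e4, hdm, mul_add, Finset.sum_add_distrib, e2, Finset.sum_neg_distrib,
    inner_add_left, inner_smul_left, add_mul, Finset.sum_add_distrib]
  simp [mul_assoc]
  ring

end Energy

/-! ### Motion of the critical points -/

/-- Around a local optimum with nonsingular Hessian, the critical points move at most in proportion
to the configuration. -/
lemma exists_eventually_norm_sub_le {Ω : Set Plane} {ρ : Plane → ℝ} {ρhigh C R : ℝ}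
    {f : Plane → Plane → ℝ} (hΩ : IsCompact Ω) (hR : 0 ≤ R) (hΩR : ∀ q ∈ Ω, ‖q‖ ≤ R) (hC : 0 ≤ C)
    (hρm : Measurable ρ) (hρ : ∀ q ∈ Ω, |ρ q| ≤ ρhigh)
    (hf : ContinuousOn (fun z : Plane × Plane => f z.1 z.2) (univ ×ˢ Ω))
    (hfd : ∀ q ∈ Ω, Differentiable ℝ (fun p => f p q))
    (hfg : ContinuousOn (fun z : Plane × Plane => gradient (fun p => f p z.2) z.1) (univ ×ˢ Ω)) :
    ∃ K, 0 < K ∧ ∀ (c : ℝ → Plane × ℝ × ℝ) (x : ℝ → Plane) (t : ℝ), 0 ≤ t →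
      ContinuousOn c (Ici 0) → ContinuousOn x (Ici 0) → (∀ s, 0 ≤ s → ‖(c s).1‖ ≤ R) →
      (∀ s, 0 ≤ s → x s ∈ admissible Ω ρ f (c s).1 (c s).2.1 (c s).2.2) →
      (hessian Ω ρ f (c t).1 (c t).2.1 (c t).2.2 (x t)).rank = 2 →
      ‖(hessian Ω ρ f (c t).1 (c t).2.1 (c t).2.2 (x t)).inverse‖ ≤ C →
      ∀ᶠ z in 𝓝[>] t, ‖x z - x t‖ ≤ K * ‖c z - c t‖ := by
  obtain ⟨M, hM0, hM⟩ := exists_norm_gradient_localCost_sub_le hΩ hρm hρ hf hfd hfg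
  -- The factor `2 * C` comes from the displacement estimate, `M` from the gradient, and 3 from
  -- bounding three coordinates by the sup norm; `+ 1` makes `K` positive.
  refine ⟨2 * C * (M * (16 * R * (1 + 2 * R) * 3)) + 1, by positivity, ?_⟩
  intro c x t ht hc hx hcR hadm hrank hinv
  have hlt : 𝓝[>] t ≤ 𝓝[Ici 0] t := nhdsWithin_mono t fun s hs => ht.trans (mem_Ioi.1 hs).le
  have hct : Tendsto c (𝓝[>] t) (𝓝 (c t)) := (hc t ht).mono_left hlt
  have hxt : Tendsto x (𝓝[>] t) (𝓝 (x t)) := (hx t ht).mono_left hlt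
  have hturn := turn_ne_zero_of_rank_hessian hR hΩR hrank
  obtain ⟨hdiff, hbound⟩ := differentiableAt_and_norm_le_of_rank_eq_two hrank hinv
  have hvol := ((continuous_snd.tendsto (c t)).comp hct).eventually
    (eventually_volume_subregion_sdiff_le hR hΩR hturn)
  have hG : ∀ᶠ z in 𝓝[>] t,
      ‖gradient (localCost Ω ρ f (c t).1 (c t).2.1 (c t).2.2) (x z)‖ ≤
        M * (16 * R * (1 + 2 * R) * 3) * ‖c z - c t‖ := by
    filter_upwards [hvol, self_mem_nhdsWithin] with z hz htz
    have hz0 : 0 ≤ z := ht.trans (mem_Ioi.1 htz).le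
    -- The gradient for the configuration `c z` vanishes at `x z`, so the one for `c t` equals the
    -- difference of the two there.
    have h1 := hM (x z) (hadm z hz0).1.1 (c t).1 (c t).2.1 (c t).2.2 (c z).1 (c z).2.1 (c z).2.2
    rw [(hadm z hz0).2, zero_sub, norm_neg] at h1
    have h2 := hz (c t).1 (c z).1 (hcR t ht)
    have h3 : ‖(c z).1 - (c t).1‖ ≤ ‖c z - c t‖ := norm_fst_le (c z - c t)
    have h4 : ‖(c z).2 - (c t).2‖ ≤ ‖c z - c t‖ := norm_snd_le (c z - c t)
    have h5 : |(c z).2.1 - (c t).2.1| ≤ ‖c z - c t‖ := (norm_fst_le ((c z).2 - (c t).2)).trans h4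
    have h6 : |(c z).2.2 - (c t).2.2| ≤ ‖c z - c t‖ := (norm_snd_le ((c z).2 - (c t).2)).trans h4
    calc _ ≤ _ := h1
      _ ≤ M * (16 * R * (1 + 2 * R) *
          (‖c z - c t‖ + ‖c z - c t‖ + ‖c z - c t‖)) := by
        gcongr
        refine h2.trans ?_
        simp only [Function.comp_apply]
        gcongr
      _ = _ := by ring
  filter_upwards [eventually_norm_sub_le_of_fderiv_bound hC hdiff.hasFDerivAt hbound
    (hadm t ht).2 hxt hG] with z hz
  nlinarith [norm_nonneg (c z - c t)]

end RotaryCoverage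

/-! ### Assembly of the convergence theorem -/

theorem theorem1 {N : ℕ} [NeZero N] (hN : 2 ≤ N)
    -- the bounded coverage region `{L ≤ 0}` and the event density
    (L : RotaryCoverage.Plane → ℝ) (hL : Continuous L)
    (hbdd : Bornology.IsBounded (RotaryCoverage.region L))
    (ρ : RotaryCoverage.Plane → ℝ) (hρm : Measurable ρ) (ρlow ρhigh : ℝ) (hρpos : 0 < ρlow)
    (hρ : ∀ q ∈ RotaryCoverage.region L, ρlow ≤ ρ q ∧ ρ q ≤ ρhigh)
    -- the service cost, continuously differentiable in the position
    (f : RotaryCoverage.Plane → RotaryCoverage.Plane → ℝ)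
    (hf : ContinuousOn (fun z : RotaryCoverage.Plane × RotaryCoverage.Plane => f z.1 z.2)
      (univ ×ˢ RotaryCoverage.region L))
    (hfd : ∀ q ∈ RotaryCoverage.region L, Differentiable ℝ (fun p => f p q))
    (hfg : ContinuousOn
      (fun z : RotaryCoverage.Plane × RotaryCoverage.Plane =>
        gradient (fun p => f p z.2) z.1) (univ ×ˢ RotaryCoverage.region L))
    -- a solution of the partition dynamics with bounded reference points
    (κφ κr κp : ℝ) (hκφ : 0 < κφ) (hκr : 0 < κr) (hκp : 0 < κp)
    (φ : Fin N → ℝ → ℝ) (r : Fin N → ℝ → RotaryCoverage.Plane)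
    (hpart : RotaryCoverage.IsPartitionTrajectory (RotaryCoverage.region L) ρ κφ κr φ r)
    (hr : ∃ R : ℝ, ∀ t, 0 ≤ t → ∀ i, ‖r i t‖ ≤ R)
    -- the local optima, continuous in time, with (uniformly) nonsingular Hessians
    (pstar : Fin N → ℝ → RotaryCoverage.Plane)
    (hopt : ∀ t, 0 ≤ t → ∀ i, RotaryCoverage.IsLocalOptimum (RotaryCoverage.region L) ρ f
      (r i t) (φ i t) (φ (i + 1) t) (pstar i t))
    (hcont : ∀ i, ContinuousOn (pstar i) (Ici 0))
    (hrank : ∃ C : ℝ, ∀ t, 0 ≤ t → ∀ i,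
      (RotaryCoverage.hessian (RotaryCoverage.region L) ρ f
        (r i t) (φ i t) (φ (i + 1) t) (pstar i t)).rank = 2 ∧
      ‖(RotaryCoverage.hessian (RotaryCoverage.region L) ρ f
        (r i t) (φ i t) (φ (i + 1) t) (pstar i t)).inverse‖ ≤ C)
    -- the agents under the proportional law
    (p u : Fin N → ℝ → RotaryCoverage.Plane)
    (hagent : ∀ t, 0 ≤ t → ∀ i, HasDerivWithinAt (p i) (u i t) (Ici 0) t)
    (hcontrol : ∀ t, 0 ≤ t → ∀ i, u i t = -κp • (p i t - pstar i t)) :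
    ∀ i, Tendsto (fun t => ‖p i t - pstar i t‖) atTop (𝓝 0) := by
  intro i
  set Ω := RotaryCoverage.region L with hΩdef
  have hΩ : IsCompact Ω :=
    Metric.isCompact_of_isClosed_isBounded (isClosed_le hL continuous_const) hbdd
  obtain ⟨R₁, hR₁⟩ := hbdd.exists_norm_le
  obtain ⟨R₂, hR₂⟩ := hr
  obtain ⟨C, hC⟩ := hrank
  set R := max (max R₁ R₂) 0 with hRdef
  have hR : 0 ≤ R := le_max_right _ _
  have hΩR : ∀ q ∈ Ω, ‖q‖ ≤ R := fun q hq =>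
    (hR₁ q hq).trans ((le_max_left _ _).trans (le_max_left _ _))
  have hrR : ∀ t, 0 ≤ t → ‖r i t‖ ≤ R := fun t ht =>
    (hR₂ t ht i).trans ((le_max_right _ _).trans (le_max_left _ _))
  have hC0 : 0 ≤ C := (norm_nonneg _).trans (hC 0 le_rfl i).2
  have hρabs : ∀ q ∈ Ω, |ρ q| ≤ ρhigh := fun q hq => by
    rw [abs_of_pos (hρpos.trans_le (hρ q hq).1)]
    exact (hρ q hq).2
  obtain ⟨K, hK, hKb⟩ := RotaryCoverage.exists_eventually_norm_sub_le hΩ hR hΩR hC0 hρm hρabs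
    hf hfd hfg
  set c : ℝ → RotaryCoverage.Plane × ℝ × ℝ := fun t => (r i t, φ i t, φ (i + 1) t) with hcdef
  set c' : ℝ → RotaryCoverage.Plane × ℝ × ℝ := fun t =>
    (RotaryCoverage.refVel Ω ρ κr φ r i t, RotaryCoverage.phaseVel Ω ρ κφ φ r i t,
      RotaryCoverage.phaseVel Ω ρ κφ φ r (i + 1) t) with hcdef'
  have hc : ∀ t, 0 ≤ t → HasDerivWithinAt c (c' t) (Ici 0) t := fun t ht =>
    (hpart.reference t ht i).prodMk ((hpart.phase t ht i).prodMk (hpart.phase t ht (i + 1)))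
  -- The optimum has upper right speed at most `K` times the configuration speed.
  have hspeed : ∀ t, 0 ≤ t → ∀ s, K * ‖c' t‖ < s →
      ∀ᶠ z in 𝓝[>] t, ‖pstar i z - pstar i t‖ < s * (z - t) := by
    intro t ht s hs
    have hs' : ‖c' t‖ < s / K := by rwa [lt_div_iff₀' hK]
    have h1 := (((hc t ht).mono (Ici_subset_Ici.2 ht)).mono Ioi_subset_Ici_self).limsup_norm_slope_le
      hs'
    have h2 := hKb c (pstar i) t ht (fun t ht => (hc t ht).continuousWithinAt) (hcont i) hrR
      (fun s hs => (hopt s hs i).1) (hC t ht i).1 (hC t ht i).2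
    filter_upwards [h1, h2, self_mem_nhdsWithin] with z h1 h2 hz
    have hz' : 0 < z - t := sub_pos.2 hz
    rw [Real.norm_of_nonneg hz'.le, inv_mul_lt_iff₀ hz', ← mul_div_assoc, lt_div_iff₀' hK] at h1
    linarith
  have hsq : ∀ t, 0 ≤ t → (K * ‖c' t‖) ^ 2 ≤
      K ^ 2 * (κφ + κr) * RotaryCoverage.dissipation Ω ρ κφ κr φ r t := by
    intro t _
    have hD := RotaryCoverage.dissipation_nonneg (Ω := Ω) (ρ := ρ) (φ := φ) (r := r) hκφ hκr t
    have hφ := fun j => RotaryCoverage.phaseVel_sq_le (Ω := Ω) (ρ := ρ) (φ := φ) (r := r) hκφ hκr j t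
    have hr' := RotaryCoverage.norm_refVel_sq_le (Ω := Ω) (ρ := ρ) (φ := φ) (r := r) hκφ hκr i t
    rw [mul_pow, mul_assoc]
    gcongr
    -- The product norm is a maximum, so a single component's dissipation bound applies in each
    -- case.
    rw [hcdef', Prod.norm_mk, Prod.norm_mk]
    rcases max_choice ‖RotaryCoverage.refVel Ω ρ κr φ r i t‖
      (max ‖RotaryCoverage.phaseVel Ω ρ κφ φ r i t‖
        ‖RotaryCoverage.phaseVel Ω ρ κφ φ r (i + 1) t‖) with h | h
    · rw [h]; nlinarith
    · rw [h]
      rcases max_choice ‖RotaryCoverage.phaseVel Ω ρ κφ φ r i t‖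
        ‖RotaryCoverage.phaseVel Ω ρ κφ φ r (i + 1) t‖ with h | h
      · rw [h, Real.norm_eq_abs, sq_abs]; nlinarith [hφ i]
      · rw [h, Real.norm_eq_abs, sq_abs]; nlinarith [hφ (i + 1)]
  have hslow := RotaryCoverage.eventually_norm_sub_le_of_speed_sq_le
    (x := pstar i) (V := RotaryCoverage.energy Ω ρ φ r) (by positivity) (hcont i) hspeed
    RotaryCoverage.energy_nonneg (fun t ht => hpart.hasDerivWithinAt_energy hκφ hκr ht)
    (fun t _ => RotaryCoverage.dissipation_nonneg hκφ hκr t) hsq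
  refine RotaryCoverage.tendsto_norm_sub_of_relaxation hκp (R := R) (fun t ht => ?_)
    (fun t ht => hΩR _ (hopt t ht i).1.1.1) hslow
  rw [← hcontrol t ht i]
  exact hagent t ht i
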